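/- **Conventions.** For a set $X$ let $UX$ be the set of ultrafilters on $X$, $\dot x$ the principal ultrafilter at $x$, $Uf$ the image map of a map $f$, and $m_X:UUX\to UX$ the map $m_X(\mathfrak X)=\{A\subseteq X\mid \{\mathfrak x\in UX\mid A\in\mathfrak x\}\in\mathfrak X\}$. A relation $r$ from $X$ to $Y$ extends to ultrafilters by letting $\mathfrak x\,(Ur)\,\mathfrak y$ hold iff for all $A\in\mathfrak x$, $B\in\mathfrak y$ there are $x\in A$, $y\in B$ with $x\,r\,y$; a function $r:X\times Y\to[0,\infty]$ extends by $Ur(\mathfrak x,\mathfrak y)=\sup_{A\in\mathfrak x,B\in\mathfrak y}\inf_{x\in A,y\in B}r(x,y)$. Orders are reflexive and transitive (not necessarily antisymmetric); a metric on $X$ is a map $d:X\times X\to[0,\infty]$ with $d(x,x)=0$ and $d(x,z)\le d(x,y)+d(y,z)$. * An *ordered compact Hausdorff space* is a compact Hausdorff space $X$ with an order $\le$ that is closed in $X\times X$. $KX$ denotes the set $X$ with the topology in which an ultrafilter $\mathfrak x$ converges to $y$ iff $\lim\mathfrak x\le y$. * An *approach space* is a set $X$ with a map $a:UX\times X\to[0,\infty]$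 such that $a(\dot x,x)=0$ and $a(m_X(\mathfrak X),x)\le Ua(\mathfrak X,\mathfrak x)+a(\mathfrak x,x)$; a map $f:(X,a)\to(Y,b)$ is a *contraction* if $b(Uf(\mathfrak x),f(x))\le a(\mathfrak x,x)$. These form the category $\mathsf{App}$. $X\otimes Y$ is the set $X\times Y$ with the structure $(\mathfrak w,(x,y))\mapsto a(U\pi_1(\mathfrak w),x)+b(U\pi_2(\mathfrak w),y)$. * A *metric compact Hausdorff space* $(X,d,\alpha)$ is a metric space $(X,d)$ with a map $\alpha:UX\to X$ satisfying $\alpha(\dot x)=x$, $\alpha(m_X(\mathfrak X))=\alpha(U\alpha(\mathfrak X))$ and $d(\alpha(\mathfrak x),\alpha(\mathfrak y))\le Ud(\mathfrak x,\mathfrak y)$. $KX$ denotes the approach space $X$ with the structure $(\mathfrak x,y)\mapsto d(\alpha(\mathfrak x),y)$. * For a topological space $X$ let $MX$ be the ordered compact Hausdorff space $UX$, with the compact Hausdorff topology in which $\mathfrak X\in UUX$ converges to $m_X(\mathfrak X)$ and with the order: $\mathfrak x\le\mathfrak y$ iff there is $\mathfrak X\in UUX$ with $m_X(\mathfrak X)=\mathfrak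 x$ and $\mathfrak X\,(Ua)\,\mathfrak y$, where $a$ is the convergence relation of $X$. For an approach space $X=(X,a)$ let $MX$ be the metric compact Hausdorff space $UX$ with structure map $m_X$ and metric $d(\mathfrak x,\mathfrak y)=\inf\{Ua(\mathfrak X,\mathfrak y)\mid m_X(\mathfrak X)=\mathfrak x\}$. In both cases the *dual space* is $X^{\mathrm{op}}=K((MX)^{\mathrm{op}})$, where $(MX)^{\mathrm{op}}$ is $MX$ with the order (respectively metric) reversed and the same compact Hausdorff topology (respectively structure map). * A topological space $X$ is *exponentiable* if $X\times-:\mathsf{Top}\to\mathsf{Top}$ has a right adjoint; an approach space $X$ is *$+$-exponentiable* if $X\otimes-:\mathsf{App}\to\mathsf{App}$ has a right adjoint. **Statement.** For every ordered compact Hausdorff space $X$, the space $KX$ is exponentiable in $\mathsf{Top}$. For every metric compact Hausdorff space $X$, the approach space $KX$ is $+$-exponentiable in $\mathsf{App}$. Consequently, for every topological space $X$ the dual space $X^{\mathrm{op}}$ is exponentiable in $\mathsf{Top}$, and for every approach space $X$ the dual space $X^{\mathrm{op}}$ is $+$-exponentiable in $\mathsf{App}$. -/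

import Mathlib

open CategoryTheory MonoidalCategory Filter Topology
open scoped ENNReal

universe u

namespace UltraSpace

/-! ### The ultrafilter monad and its extension to relations and numerical relations -/

/-- The multiplication `UUX → UX` of the ultrafilter monad; the unit is `pure : X → UX` and the
functor acts on maps by `Ultrafilter.map`. -/
def mu {X : Type u} (F : Ultrafilter (Ultrafilter X)) : Ultrafilter X := F.bind id

theorem mem_mu {X : Type u} {F : Ultrafilter (Ultrafilter X)} {A : Set X} :
    A ∈ mu F ↔ {x : Ultrafilter X | A ∈ x} ∈ F := Iff.rfl

/-- The extension of a relation `r : X → Y` to a relation `Ur : UX → UY`. -/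
def URel {X Y : Type u} (r : X → Y → Prop) (x : Ultrafilter X) (y : Ultrafilter Y) : Prop :=
  ∀ A ∈ x, ∀ B ∈ y, ∃ p ∈ A, ∃ q ∈ B, r p q

/-- The extension of a numerical relation `r : X × Y → [0,∞]` to `Ur : UX × UY → [0,∞]`. -/
noncomputable def UNum {X Y : Type u} (r : X → Y → ℝ≥0∞) (x : Ultrafilter X)
    (y : Ultrafilter Y) : ℝ≥0∞ :=
  ⨆ A ∈ x, ⨆ B ∈ y, ⨅ p ∈ A, ⨅ q ∈ B, r p q

theorem UNum_le {X Y : Type u} {r : X → Y → ℝ≥0∞} {x : Ultrafilter X} {y : Ultrafilter Y}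
    {c : ℝ≥0∞} (h : URel (fun p q => r p q ≤ c) x y) : UNum r x y ≤ c := by
  refine iSup₂_le fun A hA => iSup₂_le fun B hB => ?_
  obtain ⟨p, hp, q, hq, hc⟩ := h A hA B hB
  exact (iInf₂_le p hp).trans ((iInf₂_le q hq).trans hc)

theorem rel_of_UNum_lt {X Y : Type u} {r : X → Y → ℝ≥0∞} {x : Ultrafilter X}
    {y : Ultrafilter Y} {c : ℝ≥0∞} (h : UNum r x y < c) : URel (fun p q => r p q ≤ c) x y := by
  intro A hA B hB
  by_contra hne
  push Not at hne
  refine absurd h (not_lt.2 ?_)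
  refine le_trans ?_ (le_iSup₂_of_le A hA (le_iSup₂_of_le B hB le_rfl))
  exact le_iInf₂ fun p hp => le_iInf₂ fun q hq => (hne p hp q hq).le

theorem le_add_of_forall {a b c : ℝ≥0∞} (h : ∀ p, a < p → ∀ q, b < q → c ≤ p + q) :
    c ≤ a + b := by
  rcases eq_or_ne a ∞ with rfl | ha
  · simp
  rcases eq_or_ne b ∞ with rfl | hb
  · simp
  refine ENNReal.le_of_forall_pos_le_add fun ε hε _ => ?_
  have hε' : (ε : ℝ≥0∞) / 2 ≠ 0 := by
    simpa using hε.ne'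
  refine (h _ (ENNReal.lt_add_right ha hε') _ (ENNReal.lt_add_right hb hε')).trans (le_of_eq ?_)
  rw [add_add_add_comm, ENNReal.add_halves]

/-- Lifting an instance of a relation from `X` to ultrafilters. -/
theorem exists_lift {X Y : Type u} (R : Ultrafilter X → Y → Prop) (l : Filter X)
    (y : Ultrafilter Y) (h : ∀ A ∈ l, ∀ B ∈ y, ∃ a : Ultrafilter X, A ∈ a ∧ ∃ q ∈ B, R a q) :
    ∃ F : Ultrafilter (Ultrafilter X), (mu F : Filter X) ≤ l ∧ URel R F y := by
  let G : Filter (Ultrafilter X) :=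
    (l.lift' fun A => {a : Ultrafilter X | A ∈ a}) ⊓
      ((y : Filter Y).lift' fun B => {a | ∃ q ∈ B, R a q})
  have m1 : Monotone fun A : Set X => {a : Ultrafilter X | A ∈ a} :=
    fun A A' hAA' a ha => mem_of_superset ha hAA'
  have m2 : Monotone fun B : Set Y => {a : Ultrafilter X | ∃ q ∈ B, R a q} :=
    fun B B' hBB' a ⟨q, hq, hr⟩ => ⟨q, hBB' hq, hr⟩
  have hG : G.NeBot := by
    refine inf_neBot_iff.2 fun {s} hs {t} ht => ?_
    obtain ⟨A, hA, hAs⟩ := (mem_lift'_sets m1).1 hs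
    obtain ⟨B, hB, hBt⟩ := (mem_lift'_sets m2).1 ht
    obtain ⟨a, ha, hq⟩ := h A hA B hB
    exact ⟨a, hAs ha, hBt hq⟩
  have hle : (Ultrafilter.of G : Filter _) ≤ G := Ultrafilter.of_le G
  refine ⟨Ultrafilter.of G, fun A hA => ?_, fun S hS B hB => ?_⟩
  · exact mem_mu.2 (hle (mem_inf_of_left (mem_lift' hA)))
  · have : {a | ∃ q ∈ B, R a q} ∈ Ultrafilter.of G := hle (mem_inf_of_right (mem_lift' hB))
    obtain ⟨a, ha, q, hq, hr⟩ := (Ultrafilter.of G).nonempty_of_mem (inter_mem hS this)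
    exact ⟨a, ha, q, hq, hr⟩

/-! ### Ordered compact Hausdorff spaces -/

/-- An ordered compact Hausdorff space: a preordered set with a compact Hausdorff topology such
that the order is closed in the square. The order need not be antisymmetric. -/
structure OrdCompHaus where
  carrier : Type u
  [top : TopologicalSpace carrier]
  [order : Preorder carrier]
  [compact : CompactSpace carrier]
  [hausdorff : T2Space carrier]
  [closedOrder : OrderClosedTopology carrier]

attribute [instance] OrdCompHaus.top OrdCompHaus.order OrdCompHaus.compact
  OrdCompHaus.hausdorff OrdCompHaus.closedOrder

/-- The dual of an ordered compact Hausdorff space: only the order is reversed. -/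
def OrdCompHaus.dual (X : OrdCompHaus.{u}) : OrdCompHaus.{u} where
  carrier := X.carrierᵒᵈ
  compact := X.compact
  hausdorff := X.hausdorff

/-- The convergence of ultrafilters in `KX`: the composite of the convergence of `X` with the
order of `X`. -/
def OrdCompHaus.conv (X : OrdCompHaus.{u}) (x : Ultrafilter X.carrier) (y : X.carrier) : Prop :=
  ∃ z, (x : Filter X.carrier) ≤ 𝓝 z ∧ z ≤ y

/-- The topology with convergence relation `X.conv`; see `OrdCompHaus.converges_iff`. -/
@[reducible]
def OrdCompHaus.kTopology (X : OrdCompHaus.{u}) : TopologicalSpace X.carrier where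
  IsOpen V := ∀ (x : Ultrafilter X.carrier) (y : X.carrier), X.conv x y → y ∈ V → V ∈ x
  isOpen_univ _ _ _ _ := univ_mem
  isOpen_inter _ _ hV hW x y hxy hy := inter_mem (hV x y hxy hy.1) (hW x y hxy hy.2)
  isOpen_sUnion _ hS x y hxy := fun ⟨V, hV, hy⟩ =>
    mem_of_superset (hS V hV x y hxy hy) (Set.subset_sUnion_of_mem hV)

/-- An ultrafilter converges to a point in the topology `kTopology` if and only if it does so
with respect to `conv`. -/
theorem OrdCompHaus.converges_iff (X : OrdCompHaus.{u}) (x : Ultrafilter X.carrier)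
    (y : X.carrier) : (x : Filter X.carrier) ≤ @nhds _ X.kTopology y ↔ X.conv x y := by
  constructor
  · intro h
    obtain ⟨z, -, hz⟩ := isCompact_univ.ultrafilter_le_nhds x (by simp)
    refine ⟨z, hz, ?_⟩
    by_contra hzy
    have hnb : {p : X.carrier × X.carrier | p.1 ≤ p.2}ᶜ ∈ 𝓝 (z, y) :=
      OrderClosedTopology.isClosed_le'.isOpen_compl.mem_nhds hzy
    rw [nhds_prod_eq] at hnb
    obtain ⟨s, hs, t, ht, hst⟩ := mem_prod_iff.1 hnb
    obtain ⟨C, hC, hCc, hCs⟩ := exists_mem_nhds_isClosed_subset hs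
    let V : Set X.carrier := {v | ∃ c ∈ C, c ≤ v}ᶜ
    have hV : @IsOpen _ X.kTopology V := by
      rintro w v ⟨w', hw, hwv⟩ hv
      by_contra hVw
      rw [← Ultrafilter.compl_mem_iff_notMem, compl_compl] at hVw
      have hcl : IsClosed {v : X.carrier | ∃ c ∈ C, c ≤ v} := by
        have : {v : X.carrier | ∃ c ∈ C, c ≤ v} =
            Prod.snd '' ((C ×ˢ Set.univ) ∩ {p : X.carrier × X.carrier | p.1 ≤ p.2}) := by
          ext v
          constructor
          · rintro ⟨c, hc, hcv⟩
            exact ⟨(c, v), ⟨⟨hc, trivial⟩, hcv⟩, rfl⟩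
          · rintro ⟨⟨c, v'⟩, ⟨⟨hc, -⟩, hcv⟩, rfl⟩
            exact ⟨c, hc, hcv⟩
        rw [this]
        exact ((((hCc.prod isClosed_univ).inter
          OrderClosedTopology.isClosed_le').isCompact).image continuous_snd).isClosed
      obtain ⟨c, hc, hcw⟩ := hcl.mem_of_tendsto (f := id) (b := (w : Filter X.carrier)) hw hVw
      exact hv ⟨c, hc, hcw.trans hwv⟩
    have hyV : y ∈ V := by
      rintro ⟨c, hc, hcy⟩
      exact hst (Set.mk_mem_prod (hCs hc) (mem_of_mem_nhds ht)) hcy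
    have hVx : V ∈ x := h (@IsOpen.mem_nhds _ X.kTopology _ _ hV hyV)
    have hCx : C ∈ x := hz hC
    obtain ⟨c, hcV, hc⟩ := x.nonempty_of_mem (inter_mem hVx hCx)
    exact hcV ⟨c, hc, le_rfl⟩
  · intro h V hV
    obtain ⟨W, hWV, hW, hy⟩ := (@mem_nhds_iff _ X.kTopology _ _).1 hV
    exact mem_of_superset (hW x y h hy) hWV

/-- The topological space `KX` induced by an ordered compact Hausdorff space `X`. -/
def OrdCompHaus.K (X : OrdCompHaus.{u}) : TopCat.{u} := @TopCat.of X.carrier X.kTopology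

/-- The convergence relation `UX → X` of a topological space. -/
def converges (X : TopCat.{u}) (x : Ultrafilter X) (y : X) : Prop := (x : Filter X) ≤ 𝓝 y

/-- The order on `UX` of a topological space `X` with convergence `a`: the composite of the
converse of `mu : UUX → UX` with `Ua : UUX → UX`. -/
def ultraLE (X : TopCat.{u}) (x y : Ultrafilter X) : Prop :=
  ∃ F : Ultrafilter (Ultrafilter X), mu F = x ∧ URel (converges X) F y

theorem ultraLE_iff (X : TopCat.{u}) (x y : Ultrafilter X) :
    ultraLE X x y ↔ ∀ A ∈ x, closure A ∈ y := by
  constructor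
  · rintro ⟨F, rfl, hF⟩ A hA
    by_contra hcl
    rw [← Ultrafilter.compl_mem_iff_notMem] at hcl
    obtain ⟨a, ha, q, hq, haq⟩ := hF _ (mem_mu.1 hA) _ hcl
    exact hq (mem_closure_iff_ultrafilter.2 ⟨a, ha, haq⟩)
  · intro h
    obtain ⟨F, hF, hr⟩ := exists_lift (converges X) (x : Filter X) y fun A hA B hB => by
      obtain ⟨q, hqA, hqB⟩ := y.nonempty_of_mem (inter_mem (h A hA) hB)
      obtain ⟨a, ha, haq⟩ := mem_closure_iff_ultrafilter.1 hqA
      exact ⟨a, ha, q, hqB, haq⟩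
    exact ⟨F, Ultrafilter.eq_of_le hF, hr⟩

/-- The ordered compact Hausdorff space `MX` of a topological space `X`: the set `UX` with the
order `ultraLE` and the compact Hausdorff topology whose convergence is `mu`. -/
def ordM (X : TopCat.{u}) : OrdCompHaus.{u} :=
  letI : Preorder (Ultrafilter X) :=
    { le := ultraLE X
      le_refl := fun x => (ultraLE_iff X x x).2 fun _ hA => mem_of_superset hA subset_closure
      le_trans := fun x y z hxy hyz => (ultraLE_iff X x z).2 fun A hA => by
        have := (ultraLE_iff X y z).1 hyz _ ((ultraLE_iff X x y).1 hxy A hA)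
        rwa [closure_closure] at this }
  { carrier := Ultrafilter X
    closedOrder := ⟨by
      have : {p : Ultrafilter X × Ultrafilter X | p.1 ≤ p.2} =
          ⋂ A : Set X, {p | A ∈ p.1}ᶜ ∪ {p | closure A ∈ p.2} := by
        ext p
        simp only [Set.mem_iInter, Set.mem_union, Set.mem_compl_iff]
        exact (ultraLE_iff X p.1 p.2).trans
          (forall_congr' fun A => (imp_iff_not_or (a := A ∈ p.1)))
      rw [this]
      refine isClosed_iInter fun A => IsClosed.union ?_ ?_
      · exact ((ultrafilter_isOpen_basic A).preimage continuous_fst).isClosed_compl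
      · exact (ultrafilter_isClosed_basic (closure A)).preimage continuous_snd⟩ }

/-- In the topology of `MX`, an ultrafilter `F` on `UX` converges exactly to `mu F`. -/
theorem ordM_converges_iff (X : TopCat.{u}) (F : Ultrafilter (Ultrafilter X))
    (x : Ultrafilter X) : (F : Filter (Ultrafilter X)) ≤ @nhds (ordM X).carrier (ordM X).top x ↔ mu F = x :=
  ultrafilter_converges_iff.trans eq_comm

/-- The dual space of a topological space. -/
def topOp (X : TopCat.{u}) : TopCat.{u} := (ordM X).dual.K

/-- A topological space `X` is exponentiable if `X × - : Top → Top` has a right adjoint. -/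
def IsExponentiable (X : TopCat.{u}) : Prop := (tensorLeft X).IsLeftAdjoint

/-! ### Approach spaces -/

/-- Approach spaces, described by the numerical convergence of ultrafilters. -/
structure App where
  carrier : Type u
  conv : Ultrafilter carrier → carrier → ℝ≥0∞
  conv_pure : ∀ x, conv (pure x) x = 0
  conv_mu : ∀ (F : Ultrafilter (Ultrafilter carrier)) (y : Ultrafilter carrier) (x : carrier),
    conv (mu F) x ≤ UNum conv F y + conv y x

/-- Contraction maps between approach spaces. -/
@[ext]
structure App.Hom (X Y : App.{u}) where
  toFun : X.carrier → Y.carrier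
  contractive : ∀ (x : Ultrafilter X.carrier) (y : X.carrier),
    Y.conv (x.map toFun) (toFun y) ≤ X.conv x y

instance : Category App.{u} where
  Hom X Y := App.Hom X Y
  id X := ⟨id, fun x y => by rw [Ultrafilter.map_id]; rfl⟩
  comp f g := ⟨g.toFun ∘ f.toFun, fun x y => by
    rw [← Ultrafilter.map_map]
    exact (g.contractive _ _).trans (f.contractive _ _)⟩

theorem map_mu {X Y : Type u} (f : X → Y) (F : Ultrafilter (Ultrafilter X)) :
    (mu F).map f = mu (F.map (Ultrafilter.map f)) := rfl

theorem UNum_map_le {X X' Y Y' : Type u} {r : X → Y → ℝ≥0∞} {s : X' → Y' → ℝ≥0∞} (f : X → X')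
    (g : Y → Y') (h : ∀ p q, s (f p) (g q) ≤ r p q) (x : Ultrafilter X) (y : Ultrafilter Y) :
    UNum s (x.map f) (y.map g) ≤ UNum r x y := by
  refine le_of_forall_gt_imp_ge_of_dense (α := ℝ≥0∞) fun c hc => UNum_le fun A hA B hB => ?_
  obtain ⟨p, hp, q, hq, hr⟩ := rel_of_UNum_lt hc _ (Ultrafilter.mem_map.1 hA) _
    (Ultrafilter.mem_map.1 hB)
  exact ⟨f p, hp, g q, hq, (h p q).trans hr⟩

theorem UNum_add_le {X Y : Type u} (r s : X → Y → ℝ≥0∞) (x : Ultrafilter X)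
    (y : Ultrafilter Y) : UNum r x y + UNum s x y ≤ UNum (fun p q => r p q + s p q) x y := by
  refine ENNReal.biSup_add_biSup_le' ⟨Set.univ, univ_mem⟩ ⟨Set.univ, univ_mem⟩
    fun A hA A' hA' => ?_
  refine ENNReal.biSup_add_biSup_le' ⟨Set.univ, univ_mem⟩ ⟨Set.univ, univ_mem⟩
    fun B hB B' hB' => ?_
  refine le_trans ?_ (le_iSup₂_of_le (A ∩ A') (inter_mem hA hA')
    (le_iSup₂_of_le (B ∩ B') (inter_mem hB hB') le_rfl))
  refine le_iInf₂ fun p hp => le_iInf₂ fun q hq => add_le_add ?_ ?_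
  · exact (iInf₂_le p hp.1).trans (iInf₂_le q hq.1)
  · exact (iInf₂_le p hp.2).trans (iInf₂_le q hq.2)

/-- The `+`-product `X ⊗ Y` of approach spaces: the set `X × Y` with
`(w, (x, y)) ↦ a (π₁ w, x) + b (π₂ w, y)`. -/
noncomputable def App.tensor (X Y : App.{u}) : App.{u} where
  carrier := X.carrier × Y.carrier
  conv w p := X.conv (w.map Prod.fst) p.1 + Y.conv (w.map Prod.snd) p.2
  conv_pure p := by
    rw [Ultrafilter.map_pure, Ultrafilter.map_pure, X.conv_pure, Y.conv_pure, add_zero]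
  conv_mu F w p := by
    have h1 : UNum X.conv (F.map (Ultrafilter.map Prod.fst)) (w.map Prod.fst) ≤
        UNum (fun (v : Ultrafilter (X.carrier × Y.carrier)) (q : X.carrier × Y.carrier) =>
          X.conv (v.map Prod.fst) q.1) F w :=
      UNum_map_le _ _ (fun _ _ => le_rfl) _ _
    have h2 : UNum Y.conv (F.map (Ultrafilter.map Prod.snd)) (w.map Prod.snd) ≤
        UNum (fun (v : Ultrafilter (X.carrier × Y.carrier)) (q : X.carrier × Y.carrier) =>
          Y.conv (v.map Prod.snd) q.2) F w :=
      UNum_map_le _ _ (fun _ _ => le_rfl) _ _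
    have h3 := X.conv_mu (F.map (Ultrafilter.map Prod.fst)) (w.map Prod.fst) p.1
    have h4 := Y.conv_mu (F.map (Ultrafilter.map Prod.snd)) (w.map Prod.snd) p.2
    have h5 := (add_le_add h1 h2).trans (UNum_add_le _ _ F w)
    have h6 := add_le_add h3 h4
    rw [add_add_add_comm] at h6
    exact h6.trans (add_le_add h5 le_rfl)

/-- The functor `X ⊗ - : App ⥤ App`. -/
noncomputable def App.tensorFunctor (X : App.{u}) : App.{u} ⥤ App.{u} where
  obj Y := X.tensor Y
  map {Y _} f := ⟨fun p : X.carrier × Y.carrier => (p.1, f.toFun p.2),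
    fun (w : Ultrafilter (X.carrier × Y.carrier)) (p : X.carrier × Y.carrier) =>
      add_le_add (le_refl (X.conv (w.map Prod.fst) p.1)) (f.contractive (w.map Prod.snd) p.2)⟩
  map_id _ := rfl
  map_comp _ _ := rfl

/-- An approach space `X` is `+`-exponentiable if `X ⊗ - : App ⥤ App` has a right adjoint. -/
def App.IsPlusExponentiable (X : App.{u}) : Prop := X.tensorFunctor.IsLeftAdjoint

/-! ### Metric compact Hausdorff spaces -/

/-- A metric compact Hausdorff space: an Eilenberg--Moore algebra for the ultrafilter monad on
metric spaces. Metrics take values in `[0,∞]` and need not be symmetric or separated. The maps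
`lim` satisfying `lim_pure` and `lim_mu` are the convergence maps of compact Hausdorff topologies,
and `lim_contractive` says that `lim` is a contraction `U(X,d) → (X,d)`. -/
structure MetCompHaus where
  carrier : Type u
  d : carrier → carrier → ℝ≥0∞
  d_self : ∀ x, d x x = 0
  d_triangle : ∀ x y z, d x z ≤ d x y + d y z
  lim : Ultrafilter carrier → carrier
  lim_pure : ∀ x, lim (pure x) = x
  lim_mu : ∀ F : Ultrafilter (Ultrafilter carrier), lim (mu F) = lim (F.map lim)
  lim_contractive : ∀ x y : Ultrafilter carrier, d (lim x) (lim y) ≤ UNum d x y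

/-- The dual of a metric compact Hausdorff space: only the metric is reversed. -/
def MetCompHaus.dual (X : MetCompHaus.{u}) : MetCompHaus.{u} where
  carrier := X.carrier
  d x y := X.d y x
  d_self := X.d_self
  d_triangle x y z := (X.d_triangle z y x).trans (add_comm _ _).le
  lim := X.lim
  lim_pure := X.lim_pure
  lim_mu := X.lim_mu
  lim_contractive x y := by
    refine le_of_forall_gt_imp_ge_of_dense fun c hc => (X.lim_contractive y x).trans ?_
    refine UNum_le fun A hA B hB => ?_
    obtain ⟨p, hp, q, hq, h⟩ := rel_of_UNum_lt hc B hB A hA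
    exact ⟨q, hq, p, hp, h⟩

/-- The approach space `KX` induced by a metric compact Hausdorff space `X`. -/
noncomputable def MetCompHaus.K (X : MetCompHaus.{u}) : App.{u} where
  carrier := X.carrier
  conv x y := X.d (X.lim x) y
  conv_pure x := by rw [X.lim_pure, X.d_self]
  conv_mu F y x := by
    rw [X.lim_mu]
    refine (X.d_triangle _ (X.lim y) _).trans (add_le_add ?_ le_rfl)
    refine (X.lim_contractive _ _).trans ?_
    have := UNum_map_le (r := fun (x : Ultrafilter X.carrier) y => X.d (X.lim x) y) (s := X.d)
      X.lim id (fun _ _ => le_rfl) F y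
    rwa [Ultrafilter.map_id] at this

/-- The metric on `UX` of an approach space `X` with convergence `a`: the composite of the
converse of `mu : UUX → UX` with `Ua : UUX → UX`. -/
noncomputable def App.ultraDist (X : App.{u}) (x y : Ultrafilter X.carrier) : ℝ≥0∞ :=
  ⨅ (F : Ultrafilter (Ultrafilter X.carrier)) (_ : mu F = x), UNum X.conv F y

theorem App.ultraDist_le (X : App.{u}) {x y : Ultrafilter X.carrier} {c : ℝ≥0∞}
    (h : ∀ A ∈ x, ∀ B ∈ y, ∃ a : Ultrafilter X.carrier, A ∈ a ∧ ∃ q ∈ B, X.conv a q ≤ c) :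
    X.ultraDist x y ≤ c := by
  obtain ⟨F, hF, hr⟩ := exists_lift (fun a q => X.conv a q ≤ c) (x : Filter X.carrier) y h
  exact (iInf₂_le (f := fun F (_ : mu F = x) => UNum X.conv F y) F
    (Ultrafilter.eq_of_le hF)).trans (UNum_le hr)

theorem App.exists_of_ultraDist_lt (X : App.{u}) {x y : Ultrafilter X.carrier} {c : ℝ≥0∞}
    (h : X.ultraDist x y < c) {A B : Set X.carrier} (hA : A ∈ x) (hB : B ∈ y) :
    ∃ a : Ultrafilter X.carrier, A ∈ a ∧ ∃ q ∈ B, X.conv a q ≤ c := by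
  simp only [App.ultraDist, iInf_lt_iff] at h
  obtain ⟨F, rfl, hF⟩ := h
  exact rel_of_UNum_lt hF _ (mem_mu.1 hA) B hB

/-- The metric compact Hausdorff space `MX` of an approach space `X`: the set `UX` with the
metric `ultraDist` and the convergence `mu`. -/
noncomputable def App.M (X : App.{u}) : MetCompHaus.{u} where
  carrier := Ultrafilter X.carrier
  d := X.ultraDist
  d_self x := le_antisymm (X.ultraDist_le fun A hA B hB => by
    obtain ⟨q, hqA, hqB⟩ := x.nonempty_of_mem (inter_mem hA hB)
    exact ⟨pure q, hqA, q, hqB, (X.conv_pure q).le⟩) zero_le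
  d_triangle x y z := by
    refine le_add_of_forall fun p hp q hq => X.ultraDist_le fun A hA C hC => ?_
    let B : Set X.carrier := {b | ∃ a : Ultrafilter X.carrier, A ∈ a ∧ X.conv a b ≤ p}
    have hB : B ∈ y := by
      by_contra hB
      rw [← Ultrafilter.compl_mem_iff_notMem] at hB
      obtain ⟨a, ha, b, hb, hab⟩ := X.exists_of_ultraDist_lt hp hA hB
      exact hb ⟨a, ha, hab⟩
    obtain ⟨b, hb, c, hc, hbc⟩ := X.exists_of_ultraDist_lt hq hB hC
    obtain ⟨F, hF, hr⟩ := exists_lift (fun a q => X.conv a q ≤ p) (𝓟 A) b fun A' hA' B' hB' => by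
      obtain ⟨v, ⟨a, ha, hav⟩, hv⟩ := b.nonempty_of_mem (inter_mem hb hB')
      exact ⟨a, mem_of_superset ha hA', v, hv, hav⟩
    exact ⟨mu F, hF (mem_principal_self A), c, hc,
      (X.conv_mu F b c).trans (add_le_add (UNum_le hr) hbc)⟩
  lim := mu
  lim_pure _ := rfl
  lim_mu _ := rfl
  lim_contractive F G := by
    refine le_of_forall_gt_imp_ge_of_dense fun c hc => ?_
    refine le_of_forall_gt_imp_ge_of_dense fun c' hc' => X.ultraDist_le fun A hA B hB => ?_
    obtain ⟨x, hx, y, hy, hxy⟩ := rel_of_UNum_lt hc _ (mem_mu.1 hA) _ (mem_mu.1 hB)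
    exact X.exists_of_ultraDist_lt (hxy.trans_lt hc') hx hy

/-- The dual space of an approach space. -/
noncomputable def App.op (X : App.{u}) : App.{u} := X.M.dual.K

end UltraSpace

namespace UltraSpace

/-! ### Ordered compact Hausdorff spaces induce locally compact spaces -/

namespace OrdCompHaus

variable (X : OrdCompHaus.{u})

/-! In the topological case, the opens of `KX` are the open lower sets of `X`. Normality of the
compact Hausdorff topology, applied to the closed set of points below `y`, shows that `KX` is
locally compact (`exists_isOpen_subset_isClosed`), and locally compact spaces are exponentiable
through the compact-open topology.

In the approach case, the contractions `KX → Z` carry the least numerical convergence making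
evaluation contractive. For an arbitrary approach space in place of `KX` this has every property of
an exponential except possibly the inequality for `mu`. That inequality (`MetCompHaus.homConv_mu`)
needs interpolation: an ultrafilter of ultrafilters on `X` can be replaced by the ultrafilter of
their limits. Each ultrafilter converges to its limit at cost 0, and the algebra law `lim_mu` keeps
the final limit the same. Lifting lemmas for ultrafilters provide the required ultrafilters on
products.

Dual spaces have the form `KY` by definition, so they are special cases. -/

theorem isClosed_upperClosure {C : Set X.carrier} (hC : IsClosed C) :
    IsClosed (upperClosure C : Set X.carrier) := by
  have : (upperClosure C : Set X.carrier) =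
      Prod.snd '' ((C ×ˢ Set.univ) ∩ {p : X.carrier × X.carrier | p.1 ≤ p.2}) := by
    ext v
    constructor
    · rintro ⟨c, hc, hcv⟩
      exact ⟨(c, v), ⟨⟨hc, trivial⟩, hcv⟩, rfl⟩
    · rintro ⟨⟨c, v'⟩, ⟨⟨hc, -⟩, hcv⟩, rfl⟩
      exact ⟨c, hc, hcv⟩
  rw [this]
  exact ((((hC.prod isClosed_univ).inter
    OrderClosedTopology.isClosed_le').isCompact).image continuous_snd).isClosed

/-- An ultrafilter with limit `y` itself tests openness in `X`; the principal ultrafilter at some `z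
≤ y` tests being a lower set. -/
theorem isOpen_kTopology_iff {V : Set X.carrier} :
    IsOpen[X.kTopology] V ↔ IsOpen V ∧ IsLowerSet V := by
  constructor
  · refine fun h => ⟨isOpen_iff_ultrafilter.2 fun y hy x hx => h x y ⟨y, hx, le_rfl⟩ hy,
      fun y z hzy hy => ?_⟩
    exact Ultrafilter.mem_pure.1 (h (pure z) y ⟨z, pure_le_nhds z, hzy⟩ hy)
  · rintro ⟨hV, hl⟩ x y ⟨z, hz, hzy⟩ hy
    exact hz (hV.mem_nhds (hl hzy hy))

theorem le_kTopology : X.top ≤ X.kTopology :=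
  fun _ hV => (X.isOpen_kTopology_iff.1 hV).1

/-- This gives local compactness of `KX`. The set `W` need not be lower: it only has to be compact,
whereas `U` has to be open in `KX`. -/
theorem exists_isOpen_subset_isClosed {V : Set X.carrier} (hV : IsOpen V) (hl : IsLowerSet V)
    {y : X.carrier} (hy : y ∈ V) :
    ∃ U W : Set X.carrier, IsOpen U ∧ IsLowerSet U ∧ IsClosed W ∧ y ∈ U ∧ U ⊆ W ∧ W ⊆ V := by
  obtain ⟨U, hU, hyU, hUV⟩ := normal_exists_closure_subset (isClosed_Iic (a := y)) hV
    fun z hz => hl hz hy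
  -- The largest lower set inside `U`. It contains `y` because all of `Iic y` lies in `U`.
  refine ⟨(upperClosure Uᶜ : Set X.carrier)ᶜ, closure U,
    (X.isClosed_upperClosure hU.isClosed_compl).isOpen_compl, (upperClosure Uᶜ).upper.compl,
    isClosed_closure, ?_, fun z hz => ?_, hUV⟩
  · rintro ⟨c, hc, hcy⟩
    exact hc (hyU hcy)
  · by_contra hzU
    exact hz (subset_upperClosure fun h => hzU (subset_closure h))

instance : LocallyCompactSpace X.K where
  local_compact_nhds y N hN := by
    obtain ⟨V, hVN, hV, hy⟩ := (@mem_nhds_iff _ X.kTopology _ _).1 hN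
    obtain ⟨hV, hl⟩ := X.isOpen_kTopology_iff.1 hV
    obtain ⟨U, W, hU, hUl, hW, hyU, hUW, hWV⟩ := X.exists_isOpen_subset_isClosed hV hl hy
    refine ⟨W, (@mem_nhds_iff _ X.kTopology _ _).2
      ⟨U, hUW, X.isOpen_kTopology_iff.2 ⟨hU, hUl⟩, hyU⟩, hWV.trans hVN, ?_⟩
    -- `W` is compact in `X`, and the identity to the coarser topology of `KX` preserves
    -- compactness.
    have h := @IsCompact.image X.carrier X.carrier X.top X.kTopology W id hW.isCompact
      (continuous_id_of_le X.le_kTopology)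
    rw [Set.image_id] at h
    exact h

end OrdCompHaus

/-- Currying for maps out of a product with a locally compact space. -/
def topCurryEquiv (X : TopCat.{u}) [LocallyCompactSpace X] (Y Z : TopCat.{u}) :
    ((tensorLeft X).obj Y ⟶ Z) ≃ (Y ⟶ TopCat.of C(X, Z)) where
  toFun f := TopCat.ofHom (ContinuousMap.curry
    (ContinuousMap.comp (f.hom : C(X × Y, Z)) ContinuousMap.prodSwap))
  -- Local compactness of `X` enters here, as continuity of evaluation; currying needs none.
  invFun g := TopCat.ofHom (X := (tensorLeft X).obj Y) (Y := Z)
    ((ContinuousMap.uncurry g.hom).comp ContinuousMap.prodSwap : C(X × Y, Z))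
  left_inv _ := rfl
  right_inv _ := rfl

theorem isExponentiable_of_locallyCompactSpace (X : TopCat.{u}) [LocallyCompactSpace X] :
    IsExponentiable X :=
  (Adjunction.adjunctionOfEquivRight (F := tensorLeft X) (topCurryEquiv X)
    fun _ _ _ _ _ => rfl).isLeftAdjoint

/-! ### Lifting ultrafilters -/

/-- The ultrafilter functor preserves weak pullbacks. -/
theorem exists_ultrafilter_map_eq {A B C D : Type u} (p : A → B) (q : A → C) (f : B → D)
    (g : C → D) (hA : ∀ b c, f b = g c → ∃ a, p a = b ∧ q a = c) (x : Ultrafilter B)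
    (y : Ultrafilter C) (hxy : x.map f = y.map g) :
    ∃ w : Ultrafilter A, w.map p = x ∧ w.map q = y := by
  have : (comap p (x : Filter B) ⊓ comap q (y : Filter C)).NeBot := by
    refine inf_neBot_iff.2 fun {s} hs {t} ht => ?_
    obtain ⟨S, hS, hSs⟩ := hs
    obtain ⟨T, hT, hTt⟩ := ht
    -- The common image contains `f '' S`, so some `c ∈ T` has `g c ∈ f '' S`, and `hA` supplies a
    -- point over the matching pair.
    have h1 : f '' S ∈ y.map g := hxy ▸ Ultrafilter.mem_map.2 (mem_of_superset hS
      (Set.subset_preimage_image f S))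
    obtain ⟨c, ⟨b, hb, hbc⟩, hc⟩ := y.nonempty_of_mem (inter_mem (Ultrafilter.mem_map.1 h1) hT)
    obtain ⟨a, rfl, rfl⟩ := hA b c hbc
    exact ⟨a, hSs hb, hTt hc⟩
  obtain ⟨w, hw⟩ := Ultrafilter.exists_le (comap p (x : Filter B) ⊓ comap q (y : Filter C))
  exact ⟨w, Ultrafilter.eq_of_le (map_le_iff_le_comap.2 (hw.trans inf_le_left)),
    Ultrafilter.eq_of_le (map_le_iff_le_comap.2 (hw.trans inf_le_right))⟩

/-- The naturality squares of the multiplication of the ultrafilter monad are weak pullbacks. -/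
theorem exists_mu_eq_map_eq {A B : Type u} (f : A → B) (w : Ultrafilter A)
    (P : Ultrafilter (Ultrafilter B)) (h : w.map f = mu P) :
    ∃ W : Ultrafilter (Ultrafilter A), mu W = w ∧ W.map (Ultrafilter.map f) = P := by
  obtain ⟨W, hW, hr⟩ := exists_lift (fun (a : Ultrafilter A) q => a.map f = q) (w : Filter A) P
    fun S hS T hT => by
      have h1 : f '' S ∈ mu P := h ▸ Ultrafilter.mem_map.2 (mem_of_superset hS
        (Set.subset_preimage_image f S))
      obtain ⟨q, hq, hqT⟩ := P.nonempty_of_mem (inter_mem (mem_mu.1 h1) hT)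
      -- Since `q` contains `f '' S`, it is the image of an ultrafilter containing `S`.
      exact ⟨Ultrafilter.ofComapInfPrincipal hq, Ultrafilter.ofComapInfPrincipal_mem hq, q, hqT,
        Ultrafilter.ofComapInfPrincipal_eq_of_map hq⟩
  refine ⟨W, Ultrafilter.eq_of_le hW, (Ultrafilter.eq_of_le fun T hT => ?_)⟩
  by_contra hne
  rw [Ultrafilter.mem_coe, ← Ultrafilter.compl_mem_iff_notMem] at hne
  obtain ⟨a, ha, q, hq, rfl⟩ := hr _ (Ultrafilter.mem_map.1 hne) T hT
  exact ha hq

/-- If the relation of being related by `r` to some point over a given point holds between `x` and `y`, then the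
relation `r` holds between `x` and some ultrafilter over `y`. -/
theorem exists_URel_map_eq {A B C : Type u} (r : A → B → Prop) (g : B → C) (x : Ultrafilter A)
    (y : Ultrafilter C) (h : URel (fun a c => ∃ b, r a b ∧ g b = c) x y) :
    ∃ v : Ultrafilter B, URel r x v ∧ v.map g = y := by
  -- Any ultrafilter finer than `G` will do: it contains the `r`-image of each set of `x` and lies
  -- over `y`.
  let G : Filter B := ((x : Filter A).lift' fun S => {b | ∃ a ∈ S, r a b}) ⊓ comap g y
  have m1 : Monotone fun S : Set A => {b | ∃ a ∈ S, r a b} :=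
    fun S S' hSS' b ⟨a, ha, hr⟩ => ⟨a, hSS' ha, hr⟩
  have hG : G.NeBot := by
    refine inf_neBot_iff.2 fun {s} hs {t} ht => ?_
    obtain ⟨S, hS, hSs⟩ := (mem_lift'_sets m1).1 hs
    obtain ⟨T, hT, hTt⟩ := ht
    obtain ⟨a, ha, c, hc, b, hb, rfl⟩ := h S hS T hT
    exact ⟨b, hSs ⟨a, ha, hb⟩, hTt hc⟩
  have hle : (Ultrafilter.of G : Filter B) ≤ G := Ultrafilter.of_le G
  refine ⟨Ultrafilter.of G, fun S hS T hT => ?_,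
    Ultrafilter.eq_of_le (map_le_iff_le_comap.2 (hle.trans inf_le_right))⟩
  have hS' : {b | ∃ a ∈ S, r a b} ∈ Ultrafilter.of G := hle (mem_inf_of_left (mem_lift' hS))
  obtain ⟨b, ⟨a, ha, hr⟩, hb⟩ := (Ultrafilter.of G).nonempty_of_mem (inter_mem hS' hT)
  exact ⟨a, ha, b, hb, hr⟩

theorem URel.map {A B A' B' : Type u} {r : A → B → Prop} {s : A' → B' → Prop} {x : Ultrafilter A}
    {y : Ultrafilter B} (h : URel r x y) (f : A → A') (g : B → B')
    (hrs : ∀ a b, r a b → s (f a) (g b)) : URel s (x.map f) (y.map g) := by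
  intro S hS T hT
  obtain ⟨a, ha, b, hb, hr⟩ := h _ (Ultrafilter.mem_map.1 hS) _ (Ultrafilter.mem_map.1 hT)
  exact ⟨f a, ha, g b, hb, hrs a b hr⟩

theorem eq_of_URel_eq {A : Type u} {x y : Ultrafilter A} (h : URel Eq x y) : x = y := by
  refine (Ultrafilter.eq_of_le fun S hS => ?_).symm
  by_contra hne
  rw [Ultrafilter.mem_coe, ← Ultrafilter.compl_mem_iff_notMem] at hne
  obtain ⟨a, ha, b, hb, rfl⟩ := h S hS _ hne
  exact hb ha

/-! ### Function spaces of approach spaces -/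

/-- Evaluation of contractions. -/
def App.evalFun (X Z : App.{u}) (p : X.carrier × App.Hom X Z) : Z.carrier := p.2.toFun p.1

/-- The least numerical convergence on the set of contractions `X → Z` for which evaluation is
contractive on the `+`-product with `X`. -/
noncomputable def App.homConv (X Z : App.{u}) (p : Ultrafilter (App.Hom X Z)) (h : App.Hom X Z) :
    ℝ≥0∞ :=
  ⨆ (w : Ultrafilter (X.carrier × App.Hom X Z)) (_ : w.map Prod.snd = p) (x : X.carrier),
    Z.conv (w.map (X.evalFun Z)) (h.toFun x) - X.conv (w.map Prod.fst) x

/-- Truncated subtraction is adjoint to addition on `[0,∞]`, infinite values included, so all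
estimates can be made in additive form. -/
theorem App.homConv_le_iff {X Z : App.{u}} {p : Ultrafilter (App.Hom X Z)} {h : App.Hom X Z}
    {c : ℝ≥0∞} : X.homConv Z p h ≤ c ↔
      ∀ (w : Ultrafilter (X.carrier × App.Hom X Z)), w.map Prod.snd = p → ∀ x : X.carrier,
        Z.conv (w.map (X.evalFun Z)) (h.toFun x) ≤ X.conv (w.map Prod.fst) x + c := by
  simp only [App.homConv, iSup_le_iff, tsub_le_iff_left]

theorem App.conv_map_evalFun_le (X Z : App.{u}) (w : Ultrafilter (X.carrier × App.Hom X Z))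
    (h : App.Hom X Z) (x : X.carrier) :
    Z.conv (w.map (X.evalFun Z)) (h.toFun x) ≤
      X.conv (w.map Prod.fst) x + X.homConv Z (w.map Prod.snd) h :=
  App.homConv_le_iff.1 le_rfl w rfl x

theorem App.homConv_pure (X Z : App.{u}) (h : App.Hom X Z) : X.homConv Z (pure h) h = 0 := by
  refine le_antisymm (App.homConv_le_iff.2 fun w hw x => ?_) zero_le
  have hw' : {k | k = h} ∈ w.map Prod.snd := hw ▸ Ultrafilter.mem_pure.2 rfl
  -- `w` is concentrated on pairs with second entry `h`, where evaluation is `h` after the first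
  -- projection.
  have : w.map (X.evalFun Z) = (w.map Prod.fst).map h.toFun := by
    rw [Ultrafilter.map_map]
    refine Ultrafilter.coe_injective (Filter.map_congr ?_)
    filter_upwards [Ultrafilter.mem_map.1 hw'] with p hp
    have hp : p.2 = h := hp
    simp [App.evalFun, hp]
  rw [this, add_zero]
  exact h.contractive _ _

/-- Lift `w` to `W` over `P`, then choose `v` over `p` whose first coordinates are the limits of the
members of `W`. Passing from `W` to `v` costs only `c`, all of it in the function coordinate, and
`v` has the same limit in `X` as `w`. -/
theorem MetCompHaus.homConv_mu (X : MetCompHaus.{u}) (Z : App.{u})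
    (P : Ultrafilter (Ultrafilter (App.Hom X.K Z))) (p : Ultrafilter (App.Hom X.K Z))
    (h : App.Hom X.K Z) :
    X.K.homConv Z (mu P) h ≤ UNum (X.K.homConv Z) P p + X.K.homConv Z p h := by
  refine le_add_of_forall fun c hc c' hc' => App.homConv_le_iff.2 fun w hw x => ?_
  obtain ⟨W, rfl, rfl⟩ := exists_mu_eq_map_eq Prod.snd w P hw
  obtain ⟨v, hv, rfl⟩ := exists_URel_map_eq
    (fun (u : Ultrafilter (X.carrier × App.Hom X.K Z)) (q : X.carrier × App.Hom X.K Z) =>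
      X.lim (u.map Prod.fst) = q.1 ∧ X.K.homConv Z (u.map Prod.snd) q.2 ≤ c) Prod.snd W p
    (by
      intro S hS T hT
      obtain ⟨q, hq, k, hk, hqk⟩ := rel_of_UNum_lt hc (Ultrafilter.map Prod.snd '' S)
        (Ultrafilter.mem_map.2 (mem_of_superset hS (Set.subset_preimage_image _ S))) T hT
      obtain ⟨u, hu, rfl⟩ := hq
      -- The unnamed first coordinate is the limit of `u.map Prod.fst`.
      exact ⟨u, hu, k, hk, (_, k), ⟨rfl, hqk⟩, rfl⟩)
  have h1 : (W.map (Ultrafilter.map Prod.fst)).map X.lim = v.map Prod.fst :=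
    eq_of_URel_eq (hv.map (X.lim ∘ Ultrafilter.map Prod.fst) Prod.fst fun _ _ h => h.1)
  have h2 : X.K.conv ((mu W).map Prod.fst) x = X.K.conv (v.map Prod.fst) x := by
    have h : X.lim ((mu W).map Prod.fst) = X.lim (v.map Prod.fst) :=
      (X.lim_mu (W.map (Ultrafilter.map Prod.fst))).trans (congrArg X.lim h1)
    exact congrArg (fun z => X.d z x) h
  have h3 : UNum Z.conv (W.map (Ultrafilter.map (X.K.evalFun Z))) (v.map (X.K.evalFun Z)) ≤ c := by
    refine UNum_le (hv.map _ _ fun u q hq => ?_)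
    refine (X.K.conv_map_evalFun_le Z u q.2 q.1).trans ?_
    -- Convergence to one's own limit is free in `KX`.
    have : X.K.conv (u.map Prod.fst) q.1 = 0 := by
      rw [← hq.1]
      exact X.d_self _
    rw [this, zero_add]
    exact hq.2
  rw [h2, map_mu]
  refine (Z.conv_mu _ (v.map (X.K.evalFun Z)) _).trans ?_
  refine (add_le_add h3 (X.K.conv_map_evalFun_le Z v h x)).trans ?_
  rw [add_left_comm]
  gcongr
  exact hc'.le

/-- The exponential `Z ^ KX` with respect to the `+`-product. -/
noncomputable def MetCompHaus.exp (X : MetCompHaus.{u}) (Z : App.{u}) : App.{u} where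
  carrier := App.Hom X.K Z
  conv := X.K.homConv Z
  conv_pure := X.K.homConv_pure Z
  conv_mu := X.homConv_mu Z

/-- Evaluation, as a contraction `KX ⊗ Z ^ KX → Z`. -/
noncomputable def MetCompHaus.eval (X : MetCompHaus.{u}) (Z : App.{u}) :
    X.K.tensorFunctor.obj (X.exp Z) ⟶ Z :=
  ⟨X.K.evalFun Z, fun (w : Ultrafilter (X.K.carrier × App.Hom X.K Z))
    (p : X.K.carrier × App.Hom X.K Z) => X.K.conv_map_evalFun_le Z w p.2 p.1⟩

/-- The partial map of a contraction out of a `+`-product at a point of the second factor. -/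
def App.Hom.section {X Y Z : App.{u}} (f : App.Hom (X.tensor Y) Z) (y : Y.carrier) :
    App.Hom X Z where
  toFun x := f.toFun (x, y)
  contractive w x := by
    have h : (X.tensor Y).conv (w.map fun x => (x, y)) (x, y) ≤ X.conv w x := by
      change X.conv ((w.map fun x => (x, y)).map Prod.fst) x +
        Y.conv ((w.map fun x => (x, y)).map Prod.snd) y ≤ _
      have h1 : (w.map fun x => (x, y)).map Prod.fst = w := Ultrafilter.map_id w
      have h2 : (w.map fun x => (x, y)).map Prod.snd = pure y :=
        Ultrafilter.coe_injective (Filter.map_const (f := (w : Filter X.carrier)) (c := y))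
      rw [h1, h2, Y.conv_pure, add_zero]
    exact (f.contractive (w.map fun x => (x, y)) (x, y)).trans h

theorem App.Hom.homConv_section_le {X Y Z : App.{u}} (f : App.Hom (X.tensor Y) Z)
    (y : Ultrafilter Y.carrier) (y₀ : Y.carrier) :
    X.homConv Z (y.map f.section) (f.section y₀) ≤ Y.conv y y₀ := by
  refine App.homConv_le_iff.2 fun w hw x => ?_
  -- `X × Y` is the pullback of `X × App.Hom X Z` along `f.section`, so `w` comes from an
  -- ultrafilter on `X × Y` lying over `y`, to which contractivity of `f` applies.
  obtain ⟨v, hv, rfl⟩ := exists_ultrafilter_map_eq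
    (fun p : X.carrier × Y.carrier => (p.1, f.section p.2)) Prod.snd
    (Prod.snd : X.carrier × App.Hom X Z → App.Hom X Z) f.section
    (fun b c hbc => ⟨(b.1, c), Prod.ext rfl hbc.symm, rfl⟩) w y hw
  subst hv
  exact f.contractive v (x, y₀)

/-- Currying for contractions out of a `+`-product with `KX`. -/
noncomputable def MetCompHaus.curryEquiv (X : MetCompHaus.{u}) (Y Z : App.{u}) :
    (X.K.tensorFunctor.obj Y ⟶ Z) ≃ (Y ⟶ X.exp Z) where
  toFun f := ⟨App.Hom.section f, App.Hom.homConv_section_le f⟩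
  invFun g := X.K.tensorFunctor.map g ≫ X.eval Z
  left_inv _ := rfl
  right_inv _ := rfl

theorem MetCompHaus.isPlusExponentiable_K (X : MetCompHaus.{u}) : X.K.IsPlusExponentiable :=
  (Adjunction.adjunctionOfEquivRight (F := X.K.tensorFunctor) X.curryEquiv
    fun _ _ _ _ _ => rfl).isLeftAdjoint

end UltraSpace

theorem mainTheorem12 :
    (∀ X : UltraSpace.OrdCompHaus.{u}, UltraSpace.IsExponentiable X.K) ∧
    (∀ X : UltraSpace.MetCompHaus.{u}, X.K.IsPlusExponentiable) ∧
    (∀ X : TopCat.{u}, UltraSpace.IsExponentiable (UltraSpace.topOp X)) ∧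
    (∀ X : UltraSpace.App.{u}, X.op.IsPlusExponentiable) :=
  ⟨fun X => UltraSpace.isExponentiable_of_locallyCompactSpace X.K,
    fun X => X.isPlusExponentiable_K,
    fun X => UltraSpace.isExponentiable_of_locallyCompactSpace (UltraSpace.ordM X).dual.K,
    fun X => X.M.dual.isPlusExponentiable_K⟩
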